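/- For positive integers $s_1\ge 2$, $s_2,\dots,s_d\ge 1$ let $$\zeta(s_1,\dots,s_d)=\sum_{k_1>\cdots>k_d>0}\frac{1}{k_1^{s_1}\cdots k_d^{s_d}}.$$ For a set $S$ of permutations of the four letters $a,b,c,d$ put $\bigoplus_{S} f(a,b,c,d)=\sum_{\sigma\in S} f(\sigma(a),\sigma(b),\sigma(c),\sigma(d))$, and, in cycle notation, let $$S_1=\{e,(a\,c)(b\,d)\},\qquad S_2=\{e,\ (a\,c)(b\,d),\ (a\,c\,b),\ (b\,c),\ (b\,c\,d),\ (a\,c\,d\,b)\},$$ so that $\bigoplus_{S_2}f(a,b,c,d)=f(a,b,c,d)+f(c,d,a,b)+f(c,a,b,d)+f(a,c,b,d)+f(a,c,d,b)+f(c,a,d,b)$. For real $x,y$ and an integer $m\ge1$ write $Q_m(x,y)=\dfrac{yx^m-xy^m}{x-y}$, a polynomial in $x$ and $y$ (so for $x=y$ it means the limit $(m-1)x^m$). All summation indices are positive integers satisfying the displayed conditions, empty sums are $0$, and $0^0=1$. **Theorem.** Let $a,b,c,d$ be any real numbers. Then for any integer $n\ge 2$, $$\begin{aligned} \bigoplus_{S_1}\Big\{&\sum_{\substack{i\ge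 2\\ i+j+k+l=n}}\big[abc(a+c)^{i-1}(b+c)^{j-1}-abc^{i}(b+c)^{j-1}-ca^{i}b^{j}\big](b+d)^{k-1}d^{l}\,\zeta(i,j,k,l)\\ &+\sum_{\substack{i\ge 2\\ i+j+k+l=n}}\big[(a+c)^{i-1}-c^{i-1}\big]ab(b+c)^{j-1}c^{k}d^{l}\,\zeta(i,j,k,l) +\sum_{\substack{i\ge 2\\ i+j+l=n-1}}(b^{j}d^{l}+d^{j}b^{l})\,ca^{i}\,\zeta(i,1,j,l)\\ &+\sum_{\substack{i\ge 2\\ i+j+k+l=n}}\big[acd(a+c)^{i-1}(b+c)^{j-1}-adc^{i}(b+c)^{j-1}-cda^{i}b^{j-1}\big](b+d)^{k-1}b^{l}\,\zeta(i,j,k,l)\Big\}\\ ={}&\bigoplus_{S_2}\Big\{\sum_{\substack{i\ge 2\\ i+j+k+l=n}}a^{i}b^{j}c^{k}d^{l}\,\zeta(i,j,k,l)\Big\}\\ &+\bigoplus_{S_1}\Big\{\sum_{\substack{i\ge 2\\ i+j+k=n}}\big(Q_j(b,c)-cb^{j-1}\big)a^{i}d^{k}\,\zeta(i,j,k) +\sum_{\substack{i\ge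 2\\ i+j+k=n}}\big(Q_i(a,c)-ca^{i-1}-ac^{i-1}\big)b^{j}d^{k}\,\zeta(i,j,k)\\ &\qquad+\sum_{\substack{i\ge 2\\ i+j+k=n}}Q_k(b,d)\,a^{i}c^{j}\,\zeta(i,j,k) +\sum_{j+k=n-2}ac\,d^{j}b^{k}\,\zeta(2,j,k)\\ &\qquad+\sum_{\substack{i\ge 2\\ i+k=n-1}}ca^{i}d^{k}\,\zeta(i,1,k) -\sum_{\substack{i\ge 2\\ i+k=n-1}}Q_k(b,d)\,a^{i}c\,\zeta(i,1,k)\Big\}\\ &+\sum_{\substack{i\ge 2\\ i+j=n}}\big(Q_i(a,c)-ca^{i-1}-ac^{i-1}\big)Q_j(b,d)\,\zeta(i,j) +ac\,Q_{n-2}(b,d)\,\zeta(2,n-2), \end{aligned}$$ where the last term is omitted for $n=2$. -/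

import Mathlib

namespace DepthFour

open Finset

/-- The multiple zeta value `ζ(s₁, …, s_d) = ∑_{k₁ > ⋯ > k_d > 0} 1 / (k₁^{s₁} ⋯ k_d^{s_d})`. -/
noncomputable def mzv {d : ℕ} (s : Fin d → ℕ) : ℝ :=
  ∑' k : {k : Fin d → ℕ // StrictAnti k ∧ ∀ r, 0 < k r}, ∏ r, 1 / ((k.1 r : ℝ) ^ s r)

/-- The tuples `(s₁, …, s_d)` of positive integers with sum `n`. -/
def compositions (d n : ℕ) : Finset (Fin d → ℕ) :=
  (Finset.Nat.antidiagonalTuple d n).filter fun s => ∀ r, 1 ≤ s r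

/-- `∑ f(i, j)` over positive integers `i ≥ 2`, `j ≥ 1` with `i + j = n`. -/
noncomputable def sum₂ (n : ℕ) (f : ℕ → ℕ → ℝ) : ℝ :=
  ∑ s ∈ (compositions 2 n).filter (fun s => 2 ≤ s 0), f (s 0) (s 1)

/-- `∑ f(i, j, k)` over positive integers `i ≥ 2`, `j, k ≥ 1` with `i + j + k = n`. -/
noncomputable def sum₃ (n : ℕ) (f : ℕ → ℕ → ℕ → ℝ) : ℝ :=
  ∑ s ∈ (compositions 3 n).filter (fun s => 2 ≤ s 0), f (s 0) (s 1) (s 2)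

/-- `∑ f(i, j, k, l)` over positive integers `i ≥ 2`, `j, k, l ≥ 1` with `i + j + k + l = n`. -/
noncomputable def sum₄ (n : ℕ) (f : ℕ → ℕ → ℕ → ℕ → ℝ) : ℝ :=
  ∑ s ∈ (compositions 4 n).filter (fun s => 2 ≤ s 0), f (s 0) (s 1) (s 2) (s 3)

/-- The divided difference `(y x^m - x y^m) / (x - y)`, extended by continuity to `x = y`. -/
noncomputable def quo (x y : ℝ) (m : ℕ) : ℝ :=
  if x = y then ((m : ℝ) - 1) * x ^ m else (y * x ^ m - x * y ^ m) / (x - y)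

/-- `quo x y m` is a polynomial in `x` and `y` for `m ≥ 1`; so its value at `x = y` is the limit. -/
theorem quo_succ (x y : ℝ) (m : ℕ) :
    quo x y (m + 1) = x * y * ∑ r ∈ Finset.range m, x ^ r * y ^ (m - 1 - r) := by
  unfold quo
  split_ifs with h
  · subst h
    have : ∀ r ∈ Finset.range m, x ^ r * x ^ (m - 1 - r) = x ^ (m - 1) := by
      intro r hr
      rw [← pow_add]
      congr 1
      have := Finset.mem_range.1 hr
      omega
    rw [Finset.sum_congr rfl this, Finset.sum_const, Finset.card_range]
    rcases m with _ | m
    · simp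
    · simp
      ring
  · have h' : x - y ≠ 0 := sub_ne_zero.2 h
    rw [div_eq_iff h', mul_assoc, Commute.geom_sum₂_mul (Commute.all x y)]
    ring

/-- `⨁_S f(a, b, c, d) = ∑_{σ ∈ S} f(σ(a), σ(b), σ(c), σ(d))`, for a set `S` of permutations of
the four letters `a, b, c, d`, which are numbered `0, 1, 2, 3`. -/
noncomputable def symSum (S : Finset (Equiv.Perm (Fin 4))) (a b c d : ℝ)
    (f : ℝ → ℝ → ℝ → ℝ → ℝ) : ℝ :=
  ∑ σ ∈ S, f (![a, b, c, d] (σ 0)) (![a, b, c, d] (σ 1)) (![a, b, c, d] (σ 2))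
    (![a, b, c, d] (σ 3))

/-- `{e, (a c)(b d)}`. -/
def S₁ : Finset (Equiv.Perm (Fin 4)) :=
  {1, Equiv.swap 0 2 * Equiv.swap 1 3}

/-- `{e, (a c)(b d), (a c b), (b c), (b c d), (a c d b)}`: the permutations `σ` such that in the
word `σ(a) σ(b) σ(c) σ(d)` the letter `a` comes before `b`, and `c` before `d`. -/
def S₂ : Finset (Equiv.Perm (Fin 4)) :=
  {1, Equiv.swap 0 2 * Equiv.swap 1 3, c[0, 2, 1], Equiv.swap 1 2, c[1, 2, 3], c[0, 2, 3, 1]}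

theorem S₂_eq : S₂ = Finset.univ.filter fun σ : Equiv.Perm (Fin 4) =>
    σ.symm 0 < σ.symm 1 ∧ σ.symm 2 < σ.symm 3 := by
  decide +kernel

end DepthFour

/-!
Multiply `ζ(i, j) ζ(k, l)` by `a ^ i b ^ j c ^ k d ^ l`, sum over all exponents of weight `n` with
`i, k ≥ 2`, and expand the products once as stuffles and once as shuffles; the theorem is the
equality of the two results, which involve convergent values only.

Exponents are handled by generating series in one variable `X` that records the weight. A letter
is a power series `A`; summation over the index `m` puts `A(X / m)` in the place of
`∑ coeff i A / m ^ i`. For a word of letters `(A₁, …, A_d)`, `zetaWord n` is the corresponding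
combination of zeta values of weight `n`, and `hasSum_zetaWord` writes it as one series over chains
`k₁ > ⋯ > k_d > 0`. The relevant letters are `geom a = X / (1 - a X)` and, for an exponent which
must be at least `2`, `geom a - X`.

No product of zeta values is formed. Instead one function on pairs of chains `m > m' > 0`,
`p > p' > 0`, the coefficient of `X ^ n` in the product of the four letters, is summed in two ways,
each of which also shows that it is summable.

* Stuffle (`hasSum_stuffle`): the pairs are sorted by the relative order of `m, m', p, p'`.
* Shuffle (`hasSum_shuffle`): with `u = m - a X` and `v = p - c X`, the partial fraction identity
  `1 / (u v) = 1 / (u + v) * (1 / u + 1 / v)` adds both the indices and the parameters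
  (`geomAt_mul_geomAt`). Iterating it gives six products of four letters, in each of which the
  indices form a chain, and the pairs of chains are in bijection with the chains of length four.
  The conditions `i, k ≥ 2` are imposed by inclusion-exclusion, setting `a` or `c` to `0`; all words
  whose first exponent is `1` cancel.

It remains to expand `geom c - X` in the non-leading letters of the stuffle product and to read off
coefficients: `quo b c j` is `b c` times the `j`-th coefficient of `geom b * geom c`, and letters `X`
produce the terms `ζ(i, 1, …)` and `ζ(2, …)`.
-/

namespace DepthFour

open Finset PowerSeries

/-! ### Generating series over chains -/

/-- The chains `k₁ > ⋯ > k_d > 0`, over which a multiple zeta value of depth `d` is summed. -/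
def IsChain {d : ℕ} (k : Fin d → ℕ) : Prop :=
  StrictAnti k ∧ ∀ r, 0 < k r

theorem coeff_prod_antidiagonalTuple {R : Type*} [CommSemiring R] {d : ℕ} (n : ℕ)
    (A : Fin d → R⟦X⟧) :
    coeff n (∏ r, A r) = ∑ s ∈ Nat.antidiagonalTuple d n, ∏ r, coeff (s r) (A r) := by
  rw [coeff_prod]
  refine sum_bij' (fun l _ => ⇑l) (fun s _ => Finsupp.equivFunOnFinite.symm s) ?_ ?_ ?_ ?_ ?_
  · intro l hl
    rw [mem_finsuppAntidiag] at hl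
    exact Nat.mem_antidiagonalTuple.2 hl.1
  · intro s hs
    rw [mem_finsuppAntidiag]
    exact ⟨by simpa using Nat.mem_antidiagonalTuple.1 hs, subset_univ _⟩
  · intro l _
    ext r
    simp
  · intro s _
    ext r
    simp
  · intro l _
    rfl

theorem summable_prod_pi {d : ℕ} (f : Fin d → ℕ → ℝ) (hf : ∀ r, Summable (f r))
    (h0 : ∀ r m, 0 ≤ f r m) : Summable fun k : Fin d → ℕ => ∏ r, f r (k r) := by
  induction d with
  | zero => exact Summable.of_finite
  | succ d ih =>
    have h := (hf 0).mul_of_nonneg (ih (fun r => f r.succ) (fun r => hf _) fun r => h0 _)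
      (h0 0) fun k => prod_nonneg fun r _ => h0 _ _
    rw [← (Fin.consEquiv fun _ : Fin (d + 1) => ℕ).summable_iff]
    refine h.congr fun x => ?_
    simp [Fin.prod_univ_succ, Fin.consEquiv]

/-- Since `k₁ ≥ k_r` for all `r`, one has `k₁ ≥ ∏ k_r ^ (1 / D)` for the depth `D = d + 1`, and so the
terms of the series `ζ(2, 1, …, 1)` are at most `∏ 1 / k_r ^ (1 + 1 / D)`. -/
theorem summable_mzv {d : ℕ} (s : Fin (d + 1) → ℕ) (h0 : 2 ≤ s 0) (hs : ∀ r, 1 ≤ s r) :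
    Summable fun k : {k : Fin (d + 1) → ℕ // IsChain k} => ∏ r, 1 / ((k.1 r : ℝ) ^ s r) := by
  set p : ℝ := 1 + 1 / (d + 1) with hp
  have hp1 : 1 < p := by
    have : (0 : ℝ) < 1 / (d + 1) := by positivity
    linarith
  have hsum := summable_prod_pi (d := d + 1) (fun _ m => 1 / (m : ℝ) ^ p)
    (fun _ => Real.summable_one_div_nat_rpow.2 hp1) fun _ _ => by positivity
  refine Summable.of_nonneg_of_le (fun k => prod_nonneg fun r _ => by positivity) ?_
    (hsum.comp_injective Subtype.val_injective)
  rintro ⟨k, hk, hpos⟩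
  have hpos' : ∀ r, (1 : ℝ) ≤ k r := fun r => by exact_mod_cast hpos r
  have key : ∏ r, (k r : ℝ) ^ p ≤ ∏ r, (k r : ℝ) ^ s r := by
    calc ∏ r, (k r : ℝ) ^ p
        = (∏ r, (k r : ℝ)) * ∏ r, (k r : ℝ) ^ (1 / ((d : ℝ) + 1)) := by
          rw [← prod_mul_distrib]
          refine prod_congr rfl fun r _ => ?_
          rw [hp, Real.rpow_add (by linarith [hpos' r]), Real.rpow_one]
      _ ≤ (∏ r, (k r : ℝ)) * ∏ _r : Fin (d + 1), (k 0 : ℝ) ^ (1 / ((d : ℝ) + 1)) := by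
          gcongr with r
          exact hk.antitone (Fin.zero_le r)
      _ = (∏ r, (k r : ℝ)) * k 0 := by
          rw [prod_const, card_univ, Fintype.card_fin, ← Real.rpow_natCast,
            ← Real.rpow_mul (by positivity)]
          push_cast
          rw [one_div_mul_cancel (by positivity), Real.rpow_one]
      _ = (k 0 : ℝ) ^ 2 * ∏ r : Fin d, (k r.succ : ℝ) ^ 1 := by
          rw [Fin.prod_univ_succ]
          simp only [pow_one]
          ring
      _ ≤ (k 0 : ℝ) ^ s 0 * ∏ r : Fin d, (k r.succ : ℝ) ^ s r.succ := by
          gcongr with r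
          · exact hpos' 0
          · exact hpos' _
          · exact hs _
      _ = ∏ r, (k r : ℝ) ^ s r := (Fin.prod_univ_succ fun r => (k r : ℝ) ^ s r).symm
  have hp0 : 0 < ∏ r, (k r : ℝ) ^ p :=
    prod_pos fun r _ => Real.rpow_pos_of_pos (by linarith [hpos' r]) _
  simpa only [prod_div_distrib, prod_const_one, Function.comp_apply] using
    one_div_le_one_div_of_le hp0 key

/-- The exponents `(s₁, …, s_d)` of weight `n` for which `ζ(s₁, …, s_d)` converges. -/
def admissible (d n : ℕ) : Finset (Fin (d + 1) → ℕ) :=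
  (compositions (d + 1) n).filter fun s => 2 ≤ s 0

theorem mem_admissible {d n : ℕ} {s : Fin (d + 1) → ℕ} :
    s ∈ admissible d n ↔ (∑ r, s r = n ∧ ∀ r, 1 ≤ s r) ∧ 2 ≤ s 0 := by
  simp [admissible, compositions, Nat.mem_antidiagonalTuple]

/-- The weight-`n` part of the multilinear map which sends the word of monomials
`(X ^ s₁, …, X ^ s_d)` to `ζ(s₁, …, s_d)`, divergent values being left out. -/
noncomputable def zetaWord {d : ℕ} (n : ℕ) (A : Fin (d + 1) → ℝ⟦X⟧) : ℝ :=
  ∑ s ∈ admissible d n, (∏ r, coeff (s r) (A r)) * mzv s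

/-- `zetaWord n A` as one series over chains. The power series `A(X / m)` serves as the
factor which depends on the summation index `m`. -/
theorem hasSum_zetaWord {d : ℕ} (n : ℕ) (A : Fin (d + 1) → ℝ⟦X⟧)
    (hA : ∀ r, X ∣ A r) (hA' : X ^ 2 ∣ A 0) :
    HasSum (fun k : {k : Fin (d + 1) → ℕ // IsChain k} =>
      coeff n (∏ r, rescale ((k.1 r : ℝ)⁻¹) (A r))) (zetaWord n A) := by
  have h0 : ∀ r, coeff 0 (A r) = 0 := fun r =>
    (coeff_zero_eq_constantCoeff_apply _).trans (X_dvd_iff.1 (hA r))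
  have h1 : coeff 1 (A 0) = 0 := X_pow_dvd_iff.1 hA' 1 one_lt_two
  have h : ∀ s ∈ admissible d n,
      HasSum (fun k : {k : Fin (d + 1) → ℕ // IsChain k} =>
        (∏ r, coeff (s r) (A r)) * ∏ r, 1 / ((k.1 r : ℝ) ^ s r))
        ((∏ r, coeff (s r) (A r)) * mzv s) := by
    intro s hs
    rw [mem_admissible] at hs
    exact (summable_mzv s hs.2 hs.1.2).hasSum.mul_left _
  unfold zetaWord
  convert hasSum_sum h using 2 with k
  rw [coeff_prod_antidiagonalTuple]
  symm
  refine sum_subset_zero_on_sdiff ?_ ?_ ?_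
  · intro s hs
    exact Nat.mem_antidiagonalTuple.2 (mem_admissible.1 hs).1.1
  · intro s hs
    rw [mem_sdiff, Nat.mem_antidiagonalTuple, mem_admissible] at hs
    by_cases hs1 : ∀ r, 1 ≤ s r
    · have : s 0 = 1 := le_antisymm (by_contra fun h => hs.2 ⟨⟨hs.1, hs1⟩, by omega⟩) (hs1 0)
      exact prod_eq_zero (mem_univ 0) (by rw [coeff_rescale, this, h1, mul_zero])
    · push Not at hs1
      obtain ⟨r, hr⟩ := hs1
      exact prod_eq_zero (mem_univ r)
        (by rw [coeff_rescale, Nat.lt_one_iff.1 hr, h0, mul_zero])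
  · intro s _
    rw [← prod_mul_distrib]
    refine prod_congr rfl fun r _ => ?_
    rw [coeff_rescale, inv_pow, one_div, mul_comm]

/-- Sums over chains may be taken over any set `D` in bijection with them; outside `D` the
summand is put to `0`, so that sums over disjoint sets can be added. -/
theorem hasSum_of_chains {d : ℕ} {α : Type*} {S : ℝ} (D : α → Prop) [DecidablePred D]
    (θ : (Fin d → ℕ) → α) (θ' : α → Fin d → ℕ) (F : (Fin d → ℕ) → ℝ)
    (hF : HasSum (fun k : {k : Fin d → ℕ // IsChain k} => F k.1) S)
    (hθ : ∀ k, IsChain k → D (θ k) ∧ θ' (θ k) = k)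
    (hθ' : ∀ x, D x → IsChain (θ' x) ∧ θ (θ' x) = x) :
    HasSum (fun x => if D x then F (θ' x) else 0) S := by
  let e : {k : Fin d → ℕ // IsChain k} ≃ {x // D x} :=
    { toFun := fun k => ⟨θ k.1, (hθ k.1 k.2).1⟩
      invFun := fun x => ⟨θ' x.1, (hθ' x.1 x.2).1⟩
      left_inv := fun k => Subtype.ext (hθ k.1 k.2).2
      right_inv := fun x => Subtype.ext (hθ' x.1 x.2).2 }
  have h : HasSum (fun x : {x // D x} => F (θ' x.1)) S := by
    rw [← e.hasSum_iff]
    convert hF using 2 with k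
    exact congrArg F (hθ k.1 k.2).2
  convert (hasSum_subtype_iff_indicator (s := {x | D x})
    (f := fun x => F (θ' x))).1 h using 2 with x
  by_cases hx : D x <;> simp [hx]

/-! ### The letters and partial fractions -/

/-- The generating series `∑_{i ≥ 1} a ^ (i - 1) X ^ i = X / (1 - a X)`. -/
noncomputable def geom (a : ℝ) : ℝ⟦X⟧ := X * PowerSeries.mk fun i => a ^ i

theorem coeff_geom (a : ℝ) (i : ℕ) : coeff i (geom a) = if i = 0 then 0 else a ^ (i - 1) := by
  rcases i with _ | i
  · simp [geom]
  · simp [geom, coeff_succ_X_mul]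

theorem geom_zero : geom 0 = X := by
  ext i
  rw [coeff_geom, coeff_X]
  rcases i with _ | _ | i <;> simp

theorem one_sub_mul_geom (a : ℝ) : (1 - C a * X) * geom a = X := by
  ext i
  rcases i with _ | _ | i
  · simp [geom]
  · simp [sub_mul, coeff_geom, mul_assoc, coeff_succ_X_mul]
  · rw [sub_mul, one_mul, map_sub, mul_assoc, coeff_C_mul, coeff_succ_X_mul, coeff_geom,
      coeff_geom, coeff_X]
    simp
    ring

/-- The series `X / (m - a X)`, which is `geom a` at `X / m`. -/
noncomputable def geomAt (a : ℝ) (m : ℕ) : ℝ⟦X⟧ := rescale ((m : ℝ)⁻¹) (geom a)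

theorem sub_mul_geomAt (a : ℝ) {m : ℕ} (hm : 0 < m) : (C (m : ℝ) - C a * X) * geomAt a m = X := by
  have h := congrArg (fun A => C (m : ℝ) * rescale ((m : ℝ)⁻¹) A) (one_sub_mul_geom a)
  have hC : rescale ((m : ℝ)⁻¹) (C a) = C a := by
    ext i
    rcases i with _ | i <;> simp [coeff_C]
  have hm' : C (m : ℝ) * C ((m : ℝ)⁻¹) = (1 : ℝ⟦X⟧) := by
    rw [← map_mul, mul_inv_cancel₀ (by positivity), map_one]
  simp only [map_mul, map_sub, map_one, rescale_X, hC] at h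
  rw [geomAt]
  linear_combination h + (C a * X * rescale ((m : ℝ)⁻¹) (geom a) + X) * hm'

/-- Partial fractions, `1 / (u v) = 1 / (u + v) * (1 / u + 1 / v)`, for `u = m - a X` and
`v = p - c X`: this is what produces shuffles. -/
theorem geomAt_mul_geomAt (a c : ℝ) {m p : ℕ} (hm : 0 < m) (hp : 0 < p) :
    geomAt a m * geomAt c p = geomAt (a + c) (m + p) * (geomAt a m + geomAt c p) := by
  have h1 := sub_mul_geomAt a hm
  have h2 := sub_mul_geomAt c hp
  have h3 := sub_mul_geomAt (a + c) (Nat.add_pos_left hm p)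
  push_cast at h3
  rw [map_add, map_add] at h3
  apply mul_left_cancel₀ (X_ne_zero (R := ℝ))
  linear_combination geomAt (a + c) (m + p) * geomAt c p * h1 +
    geomAt (a + c) (m + p) * geomAt a m * h2 - geomAt a m * geomAt c p * h3

theorem X_dvd_geom (a : ℝ) : X ∣ geom a := dvd_mul_right _ _

theorem X_sq_dvd_geom_sub (a : ℝ) : X ^ 2 ∣ geom a - X := by
  rw [X_pow_dvd_iff]
  intro i hi
  rw [map_sub, coeff_geom, coeff_X]
  interval_cases i <;> simp

/-! ### Words of depth two, three and four -/

theorem isChain_two {p q : ℕ} : IsChain ![p, q] ↔ q < p ∧ 0 < q := by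
  simp only [IsChain, Fin.strictAnti_iff_succ_lt, Fin.forall_fin_succ]
  simp
  omega

theorem isChain_three {p q r : ℕ} : IsChain ![p, q, r] ↔ q < p ∧ r < q ∧ 0 < r := by
  simp only [IsChain, Fin.strictAnti_iff_succ_lt, Fin.forall_fin_succ]
  simp
  omega

theorem isChain_four {p q r s : ℕ} :
    IsChain ![p, q, r, s] ↔ q < p ∧ r < q ∧ s < r ∧ 0 < s := by
  simp only [IsChain, Fin.strictAnti_iff_succ_lt, Fin.forall_fin_succ]
  simp
  omega

theorem hasSum_zetaWord_two {α : Type*} (n : ℕ) {A B : ℝ⟦X⟧} (hA : X ^ 2 ∣ A) (hB : X ∣ B)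
    (D : α → Prop) [DecidablePred D] (θ : ℕ → ℕ → α) (u v : α → ℕ)
    (hθ : ∀ p q, q < p → 0 < q → D (θ p q) ∧ u (θ p q) = p ∧ v (θ p q) = q)
    (hθ' : ∀ x, D x → v x < u x ∧ 0 < v x ∧ θ (u x) (v x) = x) :
    HasSum (fun x => if D x then
      coeff n (rescale ((u x : ℝ)⁻¹) A * rescale ((v x : ℝ)⁻¹) B) else 0)
      (zetaWord n ![A, B]) := by
  have h := hasSum_of_chains D (fun k => θ (k 0) (k 1)) (fun x => ![u x, v x])
    (fun k => coeff n (∏ r, rescale ((k r : ℝ)⁻¹) (![A, B] r)))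
    (hasSum_zetaWord n ![A, B]
      (by simp [Fin.forall_fin_succ, hB, (dvd_pow_self X two_ne_zero).trans hA]) hA) ?_ ?_
  · simpa [Fin.prod_univ_succ] using h
  · intro k hk
    have e : k = ![k 0, k 1] := by ext r; fin_cases r <;> rfl
    rw [e, isChain_two] at hk
    obtain ⟨h, h1, h2⟩ := hθ _ _ hk.1 hk.2
    refine ⟨h, ?_⟩
    rw [h1, h2, ← e]
  · intro x hx
    obtain ⟨h1, h2, h3⟩ := hθ' x hx
    exact ⟨isChain_two.2 ⟨h1, h2⟩, h3⟩

theorem hasSum_zetaWord_three {α : Type*} (n : ℕ) {A B C : ℝ⟦X⟧}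
    (hA : X ^ 2 ∣ A) (hB : X ∣ B) (hC : X ∣ C) (D : α → Prop) [DecidablePred D]
    (θ : ℕ → ℕ → ℕ → α) (u v w : α → ℕ)
    (hθ : ∀ p q r, q < p → r < q → 0 < r →
      D (θ p q r) ∧ u (θ p q r) = p ∧ v (θ p q r) = q ∧ w (θ p q r) = r)
    (hθ' : ∀ x, D x → v x < u x ∧ w x < v x ∧ 0 < w x ∧ θ (u x) (v x) (w x) = x) :
    HasSum (fun x => if D x then
      coeff n (rescale ((u x : ℝ)⁻¹) A * rescale ((v x : ℝ)⁻¹) B *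
        rescale ((w x : ℝ)⁻¹) C) else 0)
      (zetaWord n ![A, B, C]) := by
  have h := hasSum_of_chains D (fun k => θ (k 0) (k 1) (k 2)) (fun x => ![u x, v x, w x])
    (fun k => coeff n (∏ r, rescale ((k r : ℝ)⁻¹) (![A, B, C] r)))
    (hasSum_zetaWord n ![A, B, C]
      (by simp [Fin.forall_fin_succ, hB, hC, (dvd_pow_self X two_ne_zero).trans hA]) hA) ?_ ?_
  · simpa [Fin.prod_univ_succ, mul_assoc] using h
  · intro k hk
    have e : k = ![k 0, k 1, k 2] := by ext r; fin_cases r <;> rfl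
    rw [e, isChain_three] at hk
    obtain ⟨h, h1, h2, h3⟩ := hθ _ _ _ hk.1 hk.2.1 hk.2.2
    refine ⟨h, ?_⟩
    rw [h1, h2, h3, ← e]
  · intro x hx
    obtain ⟨h1, h2, h3, h4⟩ := hθ' x hx
    exact ⟨isChain_three.2 ⟨h1, h2, h3⟩, h4⟩

theorem hasSum_zetaWord_four {α : Type*} (n : ℕ) {A B C E : ℝ⟦X⟧}
    (hA : X ^ 2 ∣ A) (hB : X ∣ B) (hC : X ∣ C) (hE : X ∣ E)
    (D : α → Prop) [DecidablePred D] (θ : ℕ → ℕ → ℕ → ℕ → α) (u v w z : α → ℕ)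
    (hθ : ∀ p q r s, q < p → r < q → s < r → 0 < s → D (θ p q r s) ∧
      u (θ p q r s) = p ∧ v (θ p q r s) = q ∧ w (θ p q r s) = r ∧ z (θ p q r s) = s)
    (hθ' : ∀ x, D x → v x < u x ∧ w x < v x ∧ z x < w x ∧ 0 < z x ∧
      θ (u x) (v x) (w x) (z x) = x) :
    HasSum (fun x => if D x then
      coeff n (rescale ((u x : ℝ)⁻¹) A * rescale ((v x : ℝ)⁻¹) B * rescale ((w x : ℝ)⁻¹) C *
        rescale ((z x : ℝ)⁻¹) E) else 0)
      (zetaWord n ![A, B, C, E]) := by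
  have h := hasSum_of_chains D (fun k => θ (k 0) (k 1) (k 2) (k 3))
    (fun x => ![u x, v x, w x, z x])
    (fun k => coeff n (∏ r, rescale ((k r : ℝ)⁻¹) (![A, B, C, E] r)))
    (hasSum_zetaWord n ![A, B, C, E]
      (by simp [Fin.forall_fin_succ, hB, hC, hE, (dvd_pow_self X two_ne_zero).trans hA]) hA) ?_ ?_
  · simpa [Fin.prod_univ_succ, mul_assoc] using h
  · intro k hk
    have e : k = ![k 0, k 1, k 2, k 3] := by ext r; fin_cases r <;> rfl
    rw [e, isChain_four] at hk
    obtain ⟨h, h1, h2, h3, h4⟩ := hθ _ _ _ _ hk.1 hk.2.1 hk.2.2.1 hk.2.2.2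
    refine ⟨h, ?_⟩
    rw [h1, h2, h3, h4, ← e]
  · intro x hx
    obtain ⟨h1, h2, h3, h4, h5⟩ := hθ' x hx
    exact ⟨isChain_four.2 ⟨h1, h2, h3, h4⟩, h5⟩

/-! ### Pairs of chains -/

/-- The index set of `ζ(i, j) ζ(k, l)`: the quadruples `((m, m'), (p, p'))` with `m > m' > 0` and
`p > p' > 0`. -/
def IsChainPair (x : (ℕ × ℕ) × ℕ × ℕ) : Prop :=
  (x.1.2 < x.1.1 ∧ 0 < x.1.2) ∧ x.2.2 < x.2.1 ∧ 0 < x.2.2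

instance : DecidablePred IsChainPair := fun x => by unfold IsChainPair; infer_instance

/-- The summand of the product of the values at the words `(A, B)` and `(C, E)`. -/
noncomputable def pairTerm (n : ℕ) (A B C E : ℝ⟦X⟧) (x : (ℕ × ℕ) × ℕ × ℕ) : ℝ :=
  coeff n (rescale ((x.1.1 : ℝ)⁻¹) A * rescale ((x.1.2 : ℝ)⁻¹) B * rescale ((x.2.1 : ℝ)⁻¹) C *
    rescale ((x.2.2 : ℝ)⁻¹) E)

theorem hasSum_comp_swap {f : (ℕ × ℕ) × ℕ × ℕ → ℝ} {S : ℝ} (h : HasSum f S) :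
    HasSum (fun x : (ℕ × ℕ) × ℕ × ℕ => f (x.2, x.1)) S :=
  (Equiv.prodComm (ℕ × ℕ) (ℕ × ℕ)).hasSum_iff.2 h

/-! ### The stuffle product -/

section Stuffle

variable (n : ℕ) {A B C E : ℝ⟦X⟧}

/-- The part of the stuffle product in which the largest index comes from the first factor only. -/
theorem hasSum_stuffle_lt (hA : X ^ 2 ∣ A) (hB : X ∣ B) (hC : X ∣ C) (hE : X ∣ E) :
    HasSum (fun x => if IsChainPair x ∧ x.2.1 < x.1.1 then pairTerm n A B C E x else 0)
      (zetaWord n ![A, B, C, E] + zetaWord n ![A, C, B, E] + zetaWord n ![A, C, E, B]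
        + zetaWord n ![A, B * C, E] + zetaWord n ![A, C, B * E]) := by
  have h1 := hasSum_zetaWord_four n hA hB hC hE
    (fun x : (ℕ × ℕ) × ℕ × ℕ => IsChainPair x ∧ x.2.1 < x.1.2)
    (fun p q r s => ((p, q), (r, s))) (fun x => x.1.1) (fun x => x.1.2) (fun x => x.2.1)
    (fun x => x.2.2)
    (by grind [IsChainPair]) (by grind [IsChainPair])
  have h2 := hasSum_zetaWord_four n hA hC hB hE
    (fun x : (ℕ × ℕ) × ℕ × ℕ => IsChainPair x ∧ x.2.1 < x.1.1 ∧ x.1.2 < x.2.1 ∧ x.2.2 < x.1.2)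
    (fun p q r s => ((p, r), (q, s))) (fun x => x.1.1) (fun x => x.2.1) (fun x => x.1.2)
    (fun x => x.2.2)
    (by grind [IsChainPair]) (by grind [IsChainPair])
  have h3 := hasSum_zetaWord_four n hA hC hE hB
    (fun x : (ℕ × ℕ) × ℕ × ℕ => IsChainPair x ∧ x.2.1 < x.1.1 ∧ x.1.2 < x.2.2)
    (fun p q r s => ((p, s), (q, r))) (fun x => x.1.1) (fun x => x.2.1) (fun x => x.2.2)
    (fun x => x.1.2)
    (by grind [IsChainPair]) (by grind [IsChainPair])
  have h4 := hasSum_zetaWord_three n hA (dvd_mul_of_dvd_left hB C) hE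
    (fun x : (ℕ × ℕ) × ℕ × ℕ => IsChainPair x ∧ x.1.2 = x.2.1)
    (fun p q r => ((p, q), (q, r))) (fun x => x.1.1) (fun x => x.1.2) (fun x => x.2.2)
    (by grind [IsChainPair]) (by grind [IsChainPair])
  have h5 := hasSum_zetaWord_three n hA hC (dvd_mul_of_dvd_left hB E)
    (fun x : (ℕ × ℕ) × ℕ × ℕ => IsChainPair x ∧ x.2.1 < x.1.1 ∧ x.1.2 = x.2.2)
    (fun p q r => ((p, r), (q, r))) (fun x => x.1.1) (fun x => x.2.1) (fun x => x.1.2)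
    (by grind [IsChainPair]) (by grind [IsChainPair])
  convert (((h1.add h2).add h3).add h4).add h5 using 2 with x
  obtain ⟨⟨m, m'⟩, p, p'⟩ := x
  by_cases hx : IsChainPair ((m, m'), (p, p'))
  · simp only [hx, true_and, pairTerm, map_mul]
    simp only [IsChainPair] at hx
    split_ifs <;> first
      | omega
      | simp only [add_zero, zero_add, mul_comm, mul_left_comm, *]
  · simp [hx]

/-- The part of the stuffle product in which the largest indices of both factors coincide. -/
theorem hasSum_stuffle_eq (hA : X ^ 2 ∣ A) (hB : X ∣ B) (hE : X ∣ E) :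
    HasSum (fun x => if IsChainPair x ∧ x.2.1 = x.1.1 then pairTerm n A B C E x else 0)
      (zetaWord n ![A * C, B, E] + zetaWord n ![A * C, E, B] + zetaWord n ![A * C, B * E]) := by
  have hAC := dvd_mul_of_dvd_left hA C
  have h1 := hasSum_zetaWord_three n hAC hB hE
    (fun x : (ℕ × ℕ) × ℕ × ℕ => IsChainPair x ∧ x.2.1 = x.1.1 ∧ x.2.2 < x.1.2)
    (fun p q r => ((p, q), (p, r))) (fun x => x.1.1) (fun x => x.1.2) (fun x => x.2.2)
    (by grind [IsChainPair]) (by grind [IsChainPair])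
  have h2 := hasSum_zetaWord_three n hAC hE hB
    (fun x : (ℕ × ℕ) × ℕ × ℕ => IsChainPair x ∧ x.2.1 = x.1.1 ∧ x.1.2 < x.2.2)
    (fun p q r => ((p, r), (p, q))) (fun x => x.1.1) (fun x => x.2.2) (fun x => x.1.2)
    (by grind [IsChainPair]) (by grind [IsChainPair])
  have h3 := hasSum_zetaWord_two n hAC (dvd_mul_of_dvd_left hB E)
    (fun x : (ℕ × ℕ) × ℕ × ℕ => IsChainPair x ∧ x.2.1 = x.1.1 ∧ x.1.2 = x.2.2)
    (fun p q => ((p, q), (p, q))) (fun x => x.1.1) (fun x => x.1.2)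
    (by grind [IsChainPair]) (by grind [IsChainPair])
  convert (h1.add h2).add h3 using 2 with x
  obtain ⟨⟨m, m'⟩, p, p'⟩ := x
  by_cases hx : IsChainPair ((m, m'), (p, p'))
  · simp only [hx, true_and, pairTerm, map_mul]
    simp only [IsChainPair] at hx
    split_ifs <;> first
      | omega
      | simp only [add_zero, zero_add, mul_comm, mul_left_comm, *]
  · simp [hx]

/-- The stuffle product `(A, B) * (C, E)`: the pairs of chains are sorted by the relative position
of their members. -/
theorem hasSum_stuffle (hA : X ^ 2 ∣ A) (hB : X ∣ B) (hC : X ^ 2 ∣ C) (hE : X ∣ E) :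
    HasSum (fun x => if IsChainPair x then pairTerm n A B C E x else 0)
      ((zetaWord n ![A, B, C, E] + zetaWord n ![A, C, B, E] + zetaWord n ![A, C, E, B]
        + zetaWord n ![A, B * C, E] + zetaWord n ![A, C, B * E])
      + (zetaWord n ![C, E, A, B] + zetaWord n ![C, A, E, B] + zetaWord n ![C, A, B, E]
        + zetaWord n ![C, E * A, B] + zetaWord n ![C, A, E * B])
      + (zetaWord n ![A * C, B, E] + zetaWord n ![A * C, E, B] + zetaWord n ![A * C, B * E])) := by
  have hX : (X : ℝ⟦X⟧) ∣ X ^ 2 := dvd_pow_self X two_ne_zero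
  convert ((hasSum_stuffle_lt n hA hB (hX.trans hC) hE).add
    (hasSum_comp_swap (hasSum_stuffle_lt n hC hE (hX.trans hA) hB))).add
    (hasSum_stuffle_eq n (C := C) hA hB hE) using 2 with x
  obtain ⟨⟨m, m'⟩, p, p'⟩ := x
  by_cases hx : IsChainPair ((m, m'), (p, p'))
  · have hx' : IsChainPair ((p, p'), (m, m')) := ⟨hx.2, hx.1⟩
    simp only [hx, hx', true_and, if_true, pairTerm]
    split_ifs <;> first
      | omega
      | simp only [add_zero, zero_add, mul_comm, mul_left_comm]
  · have hx' : ¬ IsChainPair ((p, p'), (m, m')) := fun h => hx ⟨h.2, h.1⟩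
    simp [hx, hx']

end Stuffle

/-! ### The shuffle product -/

section Shuffle

variable (n : ℕ) {A B C E : ℝ⟦X⟧}

/-- The first of the three shapes of chains produced by partial fractions:
`m + p > m + p' > m > m'`. The next two theorems treat `m + p > m + p' > m' + p' > m'` and
`m + p > m + p' > m' + p' > p'`. Each shape puts pairs of chains in bijection with chains of
length four. -/
theorem hasSum_shuffle_inner (hA : X ^ 2 ∣ A) (hB : X ∣ B) (hC : X ∣ C) (hE : X ∣ E) :
    HasSum (fun x : (ℕ × ℕ) × ℕ × ℕ => if IsChainPair x then
      coeff n (rescale (((x.1.1 + x.2.1 : ℕ) : ℝ)⁻¹) A * rescale (((x.1.1 + x.2.2 : ℕ) : ℝ)⁻¹) B *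
        rescale ((x.1.1 : ℝ)⁻¹) C * rescale ((x.1.2 : ℝ)⁻¹) E) else 0)
      (zetaWord n ![A, B, C, E]) :=
  hasSum_zetaWord_four n hA hB hC hE IsChainPair
    (fun p q r s => ((r, s), (p - r, q - r))) (fun x => x.1.1 + x.2.1) (fun x => x.1.1 + x.2.2)
    (fun x => x.1.1) (fun x => x.1.2)
    (by grind [IsChainPair]) (by grind [IsChainPair])

theorem hasSum_shuffle_left (hA : X ^ 2 ∣ A) (hB : X ∣ B) (hC : X ∣ C) (hE : X ∣ E) :
    HasSum (fun x : (ℕ × ℕ) × ℕ × ℕ => if IsChainPair x then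
      coeff n (rescale (((x.1.1 + x.2.1 : ℕ) : ℝ)⁻¹) A * rescale (((x.1.1 + x.2.2 : ℕ) : ℝ)⁻¹) B *
        rescale (((x.1.2 + x.2.2 : ℕ) : ℝ)⁻¹) C * rescale ((x.1.2 : ℝ)⁻¹) E) else 0)
      (zetaWord n ![A, B, C, E]) :=
  hasSum_zetaWord_four n hA hB hC hE IsChainPair
    (fun p q r s => ((q - r + s, s), (p - q + (r - s), r - s))) (fun x => x.1.1 + x.2.1)
    (fun x => x.1.1 + x.2.2) (fun x => x.1.2 + x.2.2) (fun x => x.1.2)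
    (by grind [IsChainPair]) (by grind [IsChainPair])

theorem hasSum_shuffle_right (hA : X ^ 2 ∣ A) (hB : X ∣ B) (hC : X ∣ C) (hE : X ∣ E) :
    HasSum (fun x : (ℕ × ℕ) × ℕ × ℕ => if IsChainPair x then
      coeff n (rescale (((x.1.1 + x.2.1 : ℕ) : ℝ)⁻¹) A * rescale (((x.1.1 + x.2.2 : ℕ) : ℝ)⁻¹) B *
        rescale (((x.1.2 + x.2.2 : ℕ) : ℝ)⁻¹) C * rescale ((x.2.2 : ℝ)⁻¹) E) else 0)
      (zetaWord n ![A, B, C, E]) :=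
  hasSum_zetaWord_four n hA hB hC hE IsChainPair
    (fun p q r s => ((q - s, r - s), (p - q + s, s))) (fun x => x.1.1 + x.2.1)
    (fun x => x.1.1 + x.2.2) (fun x => x.1.2 + x.2.2) (fun x => x.2.2)
    (by grind [IsChainPair]) (by grind [IsChainPair])

end Shuffle

/-- The part of the shuffle product of the words `(geom a - X, geom b)` and `(geom c - X, geom d)`
in which the first partial fraction expansion has kept the factor of `a`. The three rows are the
contributions of `(a, c)`, `(0, c)` and `(a, 0)`; the constant terms at `(a, 0)` cancel against
those at `(a, c)`, and likewise for `0` in place of `a`. -/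
noncomputable def shuffleHalf (n : ℕ) (a b c d : ℝ) : ℝ :=
  (zetaWord n ![geom (a + c) - X, geom (a + d), geom a, geom b]
    + zetaWord n ![geom (a + c) - X, geom (a + d), geom (b + d), geom b]
    + zetaWord n ![geom (a + c) - X, geom (a + d), geom (b + d), geom d])
  - (zetaWord n ![geom c - X, geom d, X, geom b]
    + zetaWord n ![geom c - X, geom d, geom (b + d), geom b]
    + zetaWord n ![geom c - X, geom d, geom (b + d), geom d])
  - (zetaWord n ![geom a - X, geom (a + d), geom a, geom b]
    + zetaWord n ![geom a - X, geom (a + d), geom (b + d), geom b]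
    + zetaWord n ![geom a - X, geom (a + d), geom (b + d), geom d])

/-- The summand belonging to `shuffleHalf`. -/
noncomputable def shuffleHalfTerm (a b c d : ℝ) (x : (ℕ × ℕ) × ℕ × ℕ) : ℝ⟦X⟧ :=
  let M := x.1.1 + x.2.1
  let N := x.1.1 + x.2.2
  let U := fun a' => geomAt (a' + d) N * (geomAt a' x.1.1 * geomAt b x.1.2 +
    geomAt (b + d) (x.1.2 + x.2.2) * (geomAt b x.1.2 + geomAt d x.2.2))
  (geomAt (a + c) M - geomAt 0 M) * U a - (geomAt c M - geomAt 0 M) * U 0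
    - (geomAt a M - geomAt 0 M) * U a

theorem hasSum_shuffleHalf (n : ℕ) (a b c d : ℝ) :
    HasSum (fun x => if IsChainPair x then coeff n (shuffleHalfTerm a b c d x) else 0)
      (shuffleHalf n a b c d) := by
  have h : ∀ a₁ a₂ a₃ : ℝ, HasSum (fun x => if IsChainPair x then
      coeff n ((geomAt a₁ (x.1.1 + x.2.1) - geomAt 0 (x.1.1 + x.2.1)) *
        (geomAt a₂ (x.1.1 + x.2.2) * (geomAt a₃ x.1.1 * geomAt b x.1.2 +
        geomAt (b + d) (x.1.2 + x.2.2) * (geomAt b x.1.2 + geomAt d x.2.2)))) else 0)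
      (zetaWord n ![geom a₁ - X, geom a₂, geom a₃, geom b]
        + zetaWord n ![geom a₁ - X, geom a₂, geom (b + d), geom b]
        + zetaWord n ![geom a₁ - X, geom a₂, geom (b + d), geom d]) := by
    intro a₁ a₂ a₃
    have hg := X_dvd_geom
    convert ((hasSum_shuffle_inner n (X_sq_dvd_geom_sub a₁) (hg a₂) (hg a₃) (hg b)).add
      (hasSum_shuffle_left n (X_sq_dvd_geom_sub a₁) (hg a₂) (hg (b + d)) (hg b))).add
      (hasSum_shuffle_right n (X_sq_dvd_geom_sub a₁) (hg a₂) (hg (b + d)) (hg d)) using 2 with x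
    split_ifs
    · rw [← map_add, ← map_add]
      congr 1
      simp only [geomAt, geom_zero, map_sub]
      ring
    · simp
  have key := ((h (a + c) (a + d) a).sub (h c d 0)).sub (h a (a + d) a)
  rw [geom_zero] at key
  refine (congrArg (fun f => HasSum f _) (funext fun x => ?_)).mpr key
  split_ifs
  · rw [← map_sub, ← map_sub]
    simp only [shuffleHalfTerm, zero_add]
  · simp

/-- Partial fractions, iterated until the factors of every summand belong to a chain of indices. -/
theorem geomAt_mul_geomAt_mul_geomAt_mul_geomAt (a b c d : ℝ) {m m' p p' : ℕ}
    (hm : 0 < m) (hm' : 0 < m') (hp : 0 < p) (hp' : 0 < p') :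
    geomAt a m * geomAt b m' * geomAt c p * geomAt d p' =
      geomAt (a + c) (m + p) *
        (geomAt (a + d) (m + p') * (geomAt a m * geomAt b m' +
          geomAt (b + d) (m' + p') * (geomAt b m' + geomAt d p')) +
        geomAt (c + b) (p + m') * (geomAt c p * geomAt d p' +
          geomAt (b + d) (m' + p') * (geomAt b m' + geomAt d p'))) := by
  have hac := geomAt_mul_geomAt a c hm hp
  have had := geomAt_mul_geomAt a d hm hp'
  have hcb := geomAt_mul_geomAt c b hp hm'
  have hbd := geomAt_mul_geomAt b d hm' hp'
  linear_combination geomAt b m' * geomAt d p' * hac +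
    geomAt (a + c) (m + p) * geomAt b m' * had +
    geomAt (a + c) (m + p) * geomAt d p' * hcb +
    geomAt (a + c) (m + p) * (geomAt (a + d) (m + p') + geomAt (c + b) (p + m')) * hbd

/-- The shuffle product of `(geom a - X, geom b)` and `(geom c - X, geom d)`. The summand is the
alternating sum of four products with first letters `geom a` or `geom 0 = X`, and `geom c` or
`geom 0`, each of which has a partial fraction expansion. -/
theorem hasSum_shuffle (n : ℕ) (a b c d : ℝ) :
    HasSum (fun x => if IsChainPair x then
        pairTerm n (geom a - X) (geom b) (geom c - X) (geom d) x else 0)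
      (shuffleHalf n a b c d + shuffleHalf n c d a b) := by
  convert (hasSum_shuffleHalf n a b c d).add
    (hasSum_comp_swap (hasSum_shuffleHalf n c d a b)) using 2 with x
  obtain ⟨⟨m, m'⟩, p, p'⟩ := x
  by_cases hx : IsChainPair ((m, m'), (p, p'))
  · have hx' : IsChainPair ((p, p'), (m, m')) := ⟨hx.2, hx.1⟩
    rw [if_pos hx, if_pos hx, if_pos hx', ← map_add]
    obtain ⟨⟨h1, hm'⟩, h2, hp'⟩ := hx
    simp only at h1 hm' h2 hp'
    have h := fun a c => geomAt_mul_geomAt_mul_geomAt_mul_geomAt a b c d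
      (hm'.trans h1) hm' (hp'.trans h2) hp'
    -- inclusion-exclusion over the four products
    have h1 := h a c
    have h2 := h 0 c
    have h3 := h a 0
    have h4 := h 0 0
    rw [pairTerm]
    congr 1
    simp only [shuffleHalfTerm, map_sub, ← geom_zero]
    simp only [geomAt, zero_add, add_zero, add_comm c a, add_comm d b, Nat.add_comm p m,
      Nat.add_comm p' m'] at h1 h2 h3 h4 ⊢
    linear_combination h1 - h2 - h3 + h4
  · have hx' : ¬ IsChainPair ((p, p'), (m, m')) := fun h => hx ⟨h.2, h.1⟩
    simp [hx, hx']

/-! ### The sets of permutations -/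

theorem symSum_S₁ (a b c d : ℝ) (f : ℝ → ℝ → ℝ → ℝ → ℝ) :
    symSum S₁ a b c d f = f a b c d + f c d a b := by
  rw [symSum, S₁, sum_pair (by decide)]
  rfl

theorem symSum_S₂ (a b c d : ℝ) (f : ℝ → ℝ → ℝ → ℝ → ℝ) :
    symSum S₂ a b c d f =
      f a b c d + f c d a b + f c a b d + f a c b d + f a c d b + f c a d b := by
  rw [symSum, S₂, sum_insert (by decide), sum_insert (by decide), sum_insert (by decide),
    sum_insert (by decide), sum_insert (by decide), sum_singleton]
  simp only [← add_assoc]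
  rfl

/-! ### Words as sums over exponents -/

theorem mem_compositions {d n : ℕ} {s : Fin d → ℕ} :
    s ∈ compositions d n ↔ ∑ r, s r = n ∧ ∀ r, 1 ≤ s r := by
  simp [compositions, Nat.mem_antidiagonalTuple]

theorem zetaWord_four (n : ℕ) (A B C E : ℝ⟦X⟧) : zetaWord n ![A, B, C, E] =
    sum₄ n fun i j k l =>
      coeff i A * coeff j B * coeff k C * coeff l E * mzv ![i, j, k, l] := by
  refine sum_congr rfl fun s _ => ?_
  have e : s = ![s 0, s 1, s 2, s 3] := by ext r; fin_cases r <;> rfl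
  rw [Fin.prod_univ_four]
  dsimp only
  rw [← e]
  rfl

theorem zetaWord_three (n : ℕ) (A B C : ℝ⟦X⟧) : zetaWord n ![A, B, C] =
    sum₃ n fun i j k => coeff i A * coeff j B * coeff k C * mzv ![i, j, k] := by
  refine sum_congr rfl fun s _ => ?_
  have e : s = ![s 0, s 1, s 2] := by ext r; fin_cases r <;> rfl
  rw [Fin.prod_univ_three]
  dsimp only
  rw [← e]
  rfl

theorem zetaWord_two (n : ℕ) (A B : ℝ⟦X⟧) : zetaWord n ![A, B] =
    sum₂ n fun i j => coeff i A * coeff j B * mzv ![i, j] := by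
  refine sum_congr rfl fun s _ => ?_
  have e : s = ![s 0, s 1] := by ext r; fin_cases r <;> rfl
  rw [Fin.prod_univ_two]
  dsimp only
  rw [← e]
  rfl

theorem sum₄_congr {n : ℕ} {f g : ℕ → ℕ → ℕ → ℕ → ℝ}
    (h : ∀ i j k l, 2 ≤ i → 1 ≤ j → 1 ≤ k → 1 ≤ l → f i j k l = g i j k l) :
    sum₄ n f = sum₄ n g := by
  refine sum_congr rfl fun s hs => ?_
  obtain ⟨⟨-, h1⟩, h2⟩ := mem_admissible.1 hs
  exact h _ _ _ _ h2 (h1 _) (h1 _) (h1 _)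

theorem sum₃_congr {n : ℕ} {f g : ℕ → ℕ → ℕ → ℝ}
    (h : ∀ i j k, 2 ≤ i → 1 ≤ j → 1 ≤ k → f i j k = g i j k) : sum₃ n f = sum₃ n g := by
  refine sum_congr rfl fun s hs => ?_
  obtain ⟨⟨-, h1⟩, h2⟩ := mem_admissible.1 hs
  exact h _ _ _ h2 (h1 _) (h1 _)

theorem sum₂_congr {n : ℕ} {f g : ℕ → ℕ → ℝ}
    (h : ∀ i j, 2 ≤ i → 1 ≤ j → f i j = g i j) : sum₂ n f = sum₂ n g := by
  refine sum_congr rfl fun s hs => ?_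
  obtain ⟨⟨-, h1⟩, h2⟩ := mem_admissible.1 hs
  exact h _ _ h2 (h1 _)

theorem sum₄_add (n : ℕ) (f g : ℕ → ℕ → ℕ → ℕ → ℝ) :
    sum₄ n f + sum₄ n g = sum₄ n fun i j k l => f i j k l + g i j k l := sum_add_distrib.symm

theorem sum₄_sub (n : ℕ) (f g : ℕ → ℕ → ℕ → ℕ → ℝ) :
    sum₄ n f - sum₄ n g = sum₄ n fun i j k l => f i j k l - g i j k l :=
  (sum_sub_distrib _ _).symm

theorem mul_sum₄ (n : ℕ) (r : ℝ) (f : ℕ → ℕ → ℕ → ℕ → ℝ) :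
    r * sum₄ n f = sum₄ n fun i j k l => r * f i j k l := mul_sum _ _ _

theorem sum₃_add (n : ℕ) (f g : ℕ → ℕ → ℕ → ℝ) :
    sum₃ n f + sum₃ n g = sum₃ n fun i j k => f i j k + g i j k := sum_add_distrib.symm

theorem sum₃_sub (n : ℕ) (f g : ℕ → ℕ → ℕ → ℝ) :
    sum₃ n f - sum₃ n g = sum₃ n fun i j k => f i j k - g i j k := (sum_sub_distrib _ _).symm

theorem mul_sum₃ (n : ℕ) (r : ℝ) (f : ℕ → ℕ → ℕ → ℝ) :
    r * sum₃ n f = sum₃ n fun i j k => r * f i j k := mul_sum _ _ _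

theorem sum₂_sub (n : ℕ) (f g : ℕ → ℕ → ℝ) :
    sum₂ n f - sum₂ n g = sum₂ n fun i j => f i j - g i j := (sum_sub_distrib _ _).symm

theorem mul_sum₂ (n : ℕ) (r : ℝ) (f : ℕ → ℕ → ℝ) :
    r * sum₂ n f = sum₂ n fun i j => r * f i j := mul_sum _ _ _

/-- A second letter `X` fixes the second exponent at `1`. -/
theorem zetaWord_X_second_four (n : ℕ) (A B C : ℝ⟦X⟧) : zetaWord n ![A, X, B, C] =
    sum₃ (n - 1) fun i j k => coeff i A * coeff j B * coeff k C * mzv ![i, 1, j, k] := by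
  rw [zetaWord_four, sum₄, sum₃]
  symm
  refine sum_of_injOn (fun s => ![s 0, 1, s 1, s 2]) ?_ ?_ ?_ ?_
  · intro s _ t _ h
    have h0 := congrFun h 0
    have h1 := congrFun h 2
    have h2 := congrFun h 3
    ext r
    fin_cases r
    exacts [h0, h1, h2]
  · intro s hs
    obtain ⟨⟨h1, h2⟩, h3⟩ := mem_admissible.1 hs
    refine mem_admissible.2 ⟨⟨?_, ?_⟩, h3⟩
    · simp only [Fin.sum_univ_succ] at h1 ⊢
      simp at h1 ⊢
      have := h2 0
      omega
    · intro r
      fin_cases r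
      exacts [h2 0, le_rfl, h2 1, h2 2]
  · intro s hs hs'
    rw [coeff_X, if_neg, mul_zero, zero_mul, zero_mul, zero_mul]
    intro h1
    obtain ⟨⟨h2, h3⟩, h4⟩ := mem_admissible.1 hs
    refine hs' ⟨![s 0, s 2, s 3], mem_coe.2 (mem_admissible.2 ⟨⟨?_, ?_⟩, h4⟩), ?_⟩
    · simp only [Fin.sum_univ_succ] at h2 ⊢
      simp at h2 ⊢
      omega
    · intro r
      fin_cases r
      exacts [h3 0, h3 2, h3 3]
    · ext r
      fin_cases r
      exacts [rfl, h1.symm, rfl, rfl]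
  · intro s _
    simp

theorem zetaWord_X_second_three (n : ℕ) (A B : ℝ⟦X⟧) : zetaWord n ![A, X, B] =
    sum₂ (n - 1) fun i j => coeff i A * coeff j B * mzv ![i, 1, j] := by
  rw [zetaWord_three, sum₃, sum₂]
  symm
  refine sum_of_injOn (fun s => ![s 0, 1, s 1]) ?_ ?_ ?_ ?_
  · intro s _ t _ h
    have h0 := congrFun h 0
    have h1 := congrFun h 2
    ext r
    fin_cases r
    exacts [h0, h1]
  · intro s hs
    obtain ⟨⟨h1, h2⟩, h3⟩ := mem_admissible.1 hs
    refine mem_admissible.2 ⟨⟨?_, ?_⟩, h3⟩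
    · simp only [Fin.sum_univ_succ] at h1 ⊢
      simp at h1 ⊢
      have := h2 0
      omega
    · intro r
      fin_cases r
      exacts [h2 0, le_rfl, h2 1]
  · intro s hs hs'
    rw [coeff_X, if_neg, mul_zero, zero_mul, zero_mul]
    intro h1
    obtain ⟨⟨h2, h3⟩, h4⟩ := mem_admissible.1 hs
    refine hs' ⟨![s 0, s 2], mem_coe.2 (mem_admissible.2 ⟨⟨?_, ?_⟩, h4⟩), ?_⟩
    · simp only [Fin.sum_univ_succ] at h2 ⊢
      simp at h2 ⊢
      omega
    · intro r
      fin_cases r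
      exacts [h3 0, h3 2]
    · ext r
      fin_cases r
      exacts [rfl, h1.symm, rfl]
  · intro s _
    simp

theorem zetaWord_X_sq_three (n : ℕ) (A B : ℝ⟦X⟧) : zetaWord n ![X ^ 2, A, B] =
    ∑ s ∈ compositions 2 (n - 2), coeff (s 0) A * coeff (s 1) B * mzv ![2, s 0, s 1] := by
  rw [zetaWord_three, sum₃]
  symm
  refine sum_of_injOn (fun s => ![2, s 0, s 1]) ?_ ?_ ?_ ?_
  · intro s _ t _ h
    have h0 := congrFun h 1
    have h1 := congrFun h 2
    ext r
    fin_cases r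
    exacts [h0, h1]
  · intro s hs
    obtain ⟨h1, h2⟩ := mem_compositions.1 hs
    refine mem_admissible.2 ⟨⟨?_, ?_⟩, le_rfl⟩
    · simp only [Fin.sum_univ_succ] at h1 ⊢
      simp at h1 ⊢
      have := h2 0
      omega
    · intro r
      fin_cases r
      exacts [one_le_two, h2 0, h2 1]
  · intro s hs hs'
    rw [coeff_X_pow, if_neg, zero_mul, zero_mul, zero_mul]
    intro h1
    obtain ⟨⟨h2, h3⟩, h4⟩ := mem_admissible.1 hs
    refine hs' ⟨![s 1, s 2], mem_coe.2 (mem_compositions.2 ⟨?_, ?_⟩), ?_⟩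
    · simp only [Fin.sum_univ_succ] at h2 ⊢
      simp at h2 ⊢
      omega
    · intro r
      fin_cases r
      exacts [h3 1, h3 2]
    · ext r
      fin_cases r
      exacts [h1.symm, rfl, rfl]
  · intro s _
    simp

/-- For `n = 2` the right-hand side contains the junk value `mzv ![2, 0]`, with coefficient `0`. -/
theorem zetaWord_X_sq_two {n : ℕ} (hn : 2 ≤ n) {A : ℝ⟦X⟧} (hA : coeff 0 A = 0) :
    zetaWord n ![X ^ 2, A] = coeff (n - 2) A * mzv ![2, n - 2] := by
  rw [zetaWord_two, sum₂]
  have key : ∀ s ∈ admissible 1 n, s ≠ ![2, n - 2] →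
      coeff (s 0) (X ^ 2 : ℝ⟦X⟧) * coeff (s 1) A * mzv ![s 0, s 1] = 0 := by
    intro s hs hne
    rw [coeff_X_pow, if_neg, zero_mul, zero_mul]
    intro h1
    obtain ⟨⟨h2, -⟩, -⟩ := mem_admissible.1 hs
    apply hne
    simp only [Fin.sum_univ_succ] at h2
    simp at h2
    ext r
    fin_cases r
    · exact h1
    · simp
      omega
  refine (sum_eq_single ![2, n - 2] key fun h => ?_).trans (by simp)
  have h2 : n - 2 = 0 := by
    by_contra h2
    refine h (mem_admissible.2 ⟨⟨?_, ?_⟩, le_rfl⟩)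
    · simp
      omega
    · intro r
      fin_cases r
      · exact one_le_two
      · exact Nat.one_le_iff_ne_zero.2 h2
  simp [h2, hA]

/-! ### Coefficients of the letters -/

theorem coeff_geom_of_pos (a : ℝ) {i : ℕ} (hi : 1 ≤ i) : coeff i (geom a) = a ^ (i - 1) := by
  rw [coeff_geom, if_neg (by omega)]

theorem coeff_geom_sub_X (a : ℝ) {i : ℕ} (hi : 2 ≤ i) :
    coeff i (geom a - X) = a ^ (i - 1) := by
  rw [map_sub, coeff_geom_of_pos a (by omega), coeff_X, if_neg (by omega), sub_zero]

theorem mul_coeff_geom_mul_geom (b c : ℝ) {j : ℕ} (hj : 1 ≤ j) :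
    b * c * coeff j (geom b * geom c) = quo b c j := by
  obtain ⟨m, rfl⟩ := Nat.exists_eq_add_of_le' hj
  rw [quo_succ, geom, geom, mul_assoc X, coeff_succ_X_mul]
  congr 1
  rcases m with _ | m
  · simp
  · rw [← mul_assoc, mul_comm (PowerSeries.mk _) X, mul_assoc, coeff_succ_X_mul, coeff_mul,
      Nat.sum_antidiagonal_eq_sum_range_succ_mk]
    simp

/-- The last term accounts for `j = 1`, where `c * b ^ (j - 1)` does not vanish although `X * geom b`
has no linear term. -/
theorem mul_coeff_geom_mul_geom_sub_X (b c : ℝ) {j : ℕ} (hj : 1 ≤ j) :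
    b * c * coeff j (geom b * (geom c - X)) =
      quo b c j - c * b ^ (j - 1) + c * coeff j (X : ℝ⟦X⟧) := by
  rw [mul_sub, map_sub, mul_sub, mul_coeff_geom_mul_geom b c hj]
  obtain ⟨m, rfl⟩ := Nat.exists_eq_add_of_le' hj
  rw [coeff_succ_mul_X, coeff_geom, coeff_X]
  rcases m with _ | m
  · simp
  · simp
    ring

/-- Inclusion-exclusion: the last term is the contribution `X * X` of both subtracted letters. -/
theorem mul_coeff_geom_sub_X_mul (a c : ℝ) {i : ℕ} (hi : 2 ≤ i) :
    a * c * coeff i ((geom a - X) * (geom c - X)) =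
      quo a c i - c * a ^ (i - 1) - a * c ^ (i - 1) + a * c * coeff i (X ^ 2 : ℝ⟦X⟧) := by
  have h : (geom a - X) * (geom c - X) = geom a * (geom c - X) - (geom c * X) + X ^ 2 := by ring
  rw [h, map_add, map_sub, mul_add, mul_sub, mul_coeff_geom_mul_geom_sub_X a c (by omega)]
  obtain ⟨m, rfl⟩ := Nat.exists_eq_add_of_le' hi
  rw [coeff_succ_mul_X, coeff_geom, coeff_X]
  simp
  ring

/-! ### Linearity in one letter -/

theorem zetaWord_sub_second (n : ℕ) (A B B' C E : ℝ⟦X⟧) :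
    zetaWord n ![A, B - B', C, E] = zetaWord n ![A, B, C, E] - zetaWord n ![A, B', C, E] := by
  rw [zetaWord_four, zetaWord_four, zetaWord_four, sum₄_sub]
  refine sum₄_congr fun i j k l _ _ _ _ => ?_
  rw [map_sub]
  ring

theorem zetaWord_sub_third (n : ℕ) (A B C C' E : ℝ⟦X⟧) :
    zetaWord n ![A, B, C - C', E] = zetaWord n ![A, B, C, E] - zetaWord n ![A, B, C', E] := by
  rw [zetaWord_four, zetaWord_four, zetaWord_four, sum₄_sub]
  refine sum₄_congr fun i j k l _ _ _ _ => ?_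
  rw [map_sub]
  ring

theorem zetaWord_sub_second_three (n : ℕ) (A B B' C : ℝ⟦X⟧) :
    zetaWord n ![A, B - B', C] = zetaWord n ![A, B, C] - zetaWord n ![A, B', C] := by
  rw [zetaWord_three, zetaWord_three, zetaWord_three, sum₃_sub]
  refine sum₃_congr fun i j k _ _ _ => ?_
  rw [map_sub]
  ring

theorem zetaWord_geom_four (n : ℕ) (r a b c d : ℝ) :
    r * zetaWord n ![geom a - X, geom b, geom c, geom d] = sum₄ n fun i j k l =>
      r * (a ^ (i - 1) * b ^ (j - 1) * c ^ (k - 1) * d ^ (l - 1)) * mzv ![i, j, k, l] := by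
  rw [zetaWord_four, mul_sum₄]
  refine sum₄_congr fun i j k l hi hj hk hl => ?_
  rw [coeff_geom_sub_X a hi, coeff_geom_of_pos b hj, coeff_geom_of_pos c hk,
    coeff_geom_of_pos d hl]
  ring

theorem pow_eq_mul_pow_pred (a : ℝ) {i : ℕ} (hi : 1 ≤ i) : a ^ i = a * a ^ (i - 1) :=
  (mul_pow_sub_one (by omega) a).symm

theorem sum₄_monomial (n : ℕ) (a b c d : ℝ) :
    sum₄ n (fun i j k l => a ^ i * b ^ j * c ^ k * d ^ l * mzv ![i, j, k, l]) =
      a * b * c * d * zetaWord n ![geom a - X, geom b, geom c, geom d] := by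
  rw [zetaWord_geom_four]
  refine sum₄_congr fun i j k l hi hj hk hl => ?_
  rw [pow_eq_mul_pow_pred a (by omega), pow_eq_mul_pow_pred b hj, pow_eq_mul_pow_pred c hk,
    pow_eq_mul_pow_pred d hl]
  ring

/-! ### The two sides of the identity -/

/-- The left-hand side of the theorem is the shuffle product, up to the words in which `X` is the
second or third letter. -/
theorem shuffle_sums_eq (n : ℕ) (a b c d : ℝ) :
    sum₄ n (fun i j k l =>
          (a * b * c * (a + c) ^ (i - 1) * (b + c) ^ (j - 1) - a * b * c ^ i * (b + c) ^ (j - 1)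
              - c * a ^ i * b ^ j) * (b + d) ^ (k - 1) * d ^ l * mzv ![i, j, k, l])
        + sum₄ n (fun i j k l =>
          ((a + c) ^ (i - 1) - c ^ (i - 1)) * a * b * (b + c) ^ (j - 1) * c ^ k * d ^ l
            * mzv ![i, j, k, l])
        + sum₃ (n - 1) (fun i j l =>
          (b ^ j * d ^ l + d ^ j * b ^ l) * c * a ^ i * mzv ![i, 1, j, l])
        + sum₄ n (fun i j k l =>
          (a * c * d * (a + c) ^ (i - 1) * (b + c) ^ (j - 1) - a * d * c ^ i * (b + c) ^ (j - 1)
              - c * d * a ^ i * b ^ (j - 1)) * (b + d) ^ (k - 1) * b ^ l * mzv ![i, j, k, l]) =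
      a * b * c * d * (shuffleHalf n c d a b + zetaWord n ![geom a - X, geom b, X, geom d]
        + zetaWord n ![geom a - X, X, geom b, geom d]
        + zetaWord n ![geom a - X, X, geom d, geom b]) := by
  have h3 : sum₃ (n - 1) (fun i j l =>
          (b ^ j * d ^ l + d ^ j * b ^ l) * c * a ^ i * mzv ![i, 1, j, l]) =
      a * b * c * d * (zetaWord n ![geom a - X, X, geom b, geom d]
        + zetaWord n ![geom a - X, X, geom d, geom b]) := by
    rw [zetaWord_X_second_four, zetaWord_X_second_four, sum₃_add, mul_sum₃]
    refine sum₃_congr fun i j l hi hj hl => ?_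
    rw [coeff_geom_sub_X a hi, coeff_geom_of_pos b hj, coeff_geom_of_pos d hl,
      coeff_geom_of_pos d hj, coeff_geom_of_pos b hl, pow_eq_mul_pow_pred a (by omega),
      pow_eq_mul_pow_pred b hj, pow_eq_mul_pow_pred b hl, pow_eq_mul_pow_pred d hj,
      pow_eq_mul_pow_pred d hl]
    ring
  have h124 : sum₄ n (fun i j k l =>
          (a * b * c * (a + c) ^ (i - 1) * (b + c) ^ (j - 1) - a * b * c ^ i * (b + c) ^ (j - 1)
              - c * a ^ i * b ^ j) * (b + d) ^ (k - 1) * d ^ l * mzv ![i, j, k, l])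
        + sum₄ n (fun i j k l =>
          ((a + c) ^ (i - 1) - c ^ (i - 1)) * a * b * (b + c) ^ (j - 1) * c ^ k * d ^ l
            * mzv ![i, j, k, l])
        + sum₄ n (fun i j k l =>
          (a * c * d * (a + c) ^ (i - 1) * (b + c) ^ (j - 1) - a * d * c ^ i * (b + c) ^ (j - 1)
              - c * d * a ^ i * b ^ (j - 1)) * (b + d) ^ (k - 1) * b ^ l * mzv ![i, j, k, l]) =
      a * b * c * d * (shuffleHalf n c d a b + zetaWord n ![geom a - X, geom b, X, geom d]) := by
    have e : shuffleHalf n c d a b + zetaWord n ![geom a - X, geom b, X, geom d] =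
        (zetaWord n ![geom (a + c) - X, geom (b + c), geom c, geom d]
          + zetaWord n ![geom (a + c) - X, geom (b + c), geom (b + d), geom d]
          + zetaWord n ![geom (a + c) - X, geom (b + c), geom (b + d), geom b])
        - (zetaWord n ![geom a - X, geom b, geom (b + d), geom d]
          + zetaWord n ![geom a - X, geom b, geom (b + d), geom b])
        - (zetaWord n ![geom c - X, geom (b + c), geom c, geom d]
          + zetaWord n ![geom c - X, geom (b + c), geom (b + d), geom d]
          + zetaWord n ![geom c - X, geom (b + c), geom (b + d), geom b]) := by
      rw [shuffleHalf, add_comm c a, add_comm c b, add_comm d b]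
      ring
    rw [e]
    simp only [mul_sub, mul_add, zetaWord_geom_four, sum₄_add, sum₄_sub]
    refine sum₄_congr fun i j k l hi hj hk hl => ?_
    rw [pow_eq_mul_pow_pred a (by omega : 1 ≤ i), pow_eq_mul_pow_pred c (by omega : 1 ≤ i),
      pow_eq_mul_pow_pred b hj, pow_eq_mul_pow_pred c hk, pow_eq_mul_pow_pred b hl,
      pow_eq_mul_pow_pred d hl]
    ring
  linear_combination h124 + h3

/-- The terms of depth three of the right-hand side of the theorem, as the contractions in the
stuffle product of `(geom a - X, geom b)` and `(geom c - X, geom d)`. -/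
theorem contractions_eq (n : ℕ) (a b c d : ℝ) :
    sum₃ n (fun i j k =>
          (quo b c j - c * b ^ (j - 1)) * a ^ i * d ^ k * mzv ![i, j, k])
        + sum₃ n (fun i j k =>
          (quo a c i - c * a ^ (i - 1) - a * c ^ (i - 1)) * b ^ j * d ^ k * mzv ![i, j, k])
        + sum₃ n (fun i j k => quo b d k * a ^ i * c ^ j * mzv ![i, j, k])
        + ∑ s ∈ compositions 2 (n - 2),
            a * c * d ^ s 0 * b ^ s 1 * mzv ![2, s 0, s 1]
        + sum₂ (n - 1) (fun i k => c * a ^ i * d ^ k * mzv ![i, 1, k])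
        - sum₂ (n - 1) (fun i k => quo b d k * a ^ i * c * mzv ![i, 1, k]) =
      a * b * c * d * (zetaWord n ![geom a - X, geom b * (geom c - X), geom d]
        + zetaWord n ![(geom a - X) * (geom c - X), geom b, geom d]
        - zetaWord n ![X ^ 2, geom b, geom d] + zetaWord n ![X ^ 2, geom d, geom b]
        + zetaWord n ![geom a - X, geom c - X, geom b * geom d]) := by
  have h1 : sum₃ n (fun i j k =>
          (quo b c j - c * b ^ (j - 1)) * a ^ i * d ^ k * mzv ![i, j, k]) =
      a * b * c * d * zetaWord n ![geom a - X, geom b * (geom c - X), geom d]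
        - a * c * d * zetaWord n ![geom a - X, X, geom d] := by
    rw [zetaWord_three, zetaWord_three, mul_sum₃, mul_sum₃, sum₃_sub]
    refine sum₃_congr fun i j k hi hj hk => ?_
    rw [coeff_geom_sub_X a hi, coeff_geom_of_pos d hk, pow_eq_mul_pow_pred a (by omega),
      pow_eq_mul_pow_pred d hk]
    linear_combination (- a * d * a ^ (i - 1) * d ^ (k - 1) * mzv ![i, j, k]) *
      mul_coeff_geom_mul_geom_sub_X b c hj
  have h2 : sum₃ n (fun i j k =>
          (quo a c i - c * a ^ (i - 1) - a * c ^ (i - 1)) * b ^ j * d ^ k * mzv ![i, j, k]) =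
      a * b * c * d * (zetaWord n ![(geom a - X) * (geom c - X), geom b, geom d]
        - zetaWord n ![X ^ 2, geom b, geom d]) := by
    rw [zetaWord_three, zetaWord_three, sum₃_sub, mul_sum₃]
    refine sum₃_congr fun i j k hi hj hk => ?_
    rw [coeff_geom_of_pos b hj, coeff_geom_of_pos d hk, pow_eq_mul_pow_pred b hj,
      pow_eq_mul_pow_pred d hk]
    linear_combination (- b * d * b ^ (j - 1) * d ^ (k - 1) * mzv ![i, j, k]) *
      mul_coeff_geom_sub_X_mul a c hi
  have h3 : sum₃ n (fun i j k => quo b d k * a ^ i * c ^ j * mzv ![i, j, k]) =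
      a * b * c * d * zetaWord n ![geom a - X, geom c, geom b * geom d] := by
    rw [zetaWord_three, mul_sum₃]
    refine sum₃_congr fun i j k hi hj hk => ?_
    rw [coeff_geom_sub_X a hi, coeff_geom_of_pos c hj, pow_eq_mul_pow_pred a (by omega),
      pow_eq_mul_pow_pred c hj, ← mul_coeff_geom_mul_geom b d hk]
    ring
  have h4 : ∑ s ∈ compositions 2 (n - 2), a * c * d ^ s 0 * b ^ s 1 * mzv ![2, s 0, s 1] =
      a * b * c * d * zetaWord n ![X ^ 2, geom d, geom b] := by
    rw [zetaWord_X_sq_three, mul_sum]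
    refine sum_congr rfl fun s hs => ?_
    have hs := (mem_compositions.1 hs).2
    rw [coeff_geom_of_pos d (hs 0), coeff_geom_of_pos b (hs 1), pow_eq_mul_pow_pred d (hs 0),
      pow_eq_mul_pow_pred b (hs 1)]
    ring
  have h5 : sum₂ (n - 1) (fun i k => c * a ^ i * d ^ k * mzv ![i, 1, k]) =
      a * c * d * zetaWord n ![geom a - X, X, geom d] := by
    rw [zetaWord_X_second_three, mul_sum₂]
    refine sum₂_congr fun i k hi hk => ?_
    rw [coeff_geom_sub_X a hi, coeff_geom_of_pos d hk, pow_eq_mul_pow_pred a (by omega),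
      pow_eq_mul_pow_pred d hk]
    ring
  have h6 : sum₂ (n - 1) (fun i k => quo b d k * a ^ i * c * mzv ![i, 1, k]) =
      a * b * c * d * zetaWord n ![geom a - X, X, geom b * geom d] := by
    rw [zetaWord_X_second_three, mul_sum₂]
    refine sum₂_congr fun i k hi hk => ?_
    rw [coeff_geom_sub_X a hi, pow_eq_mul_pow_pred a (by omega),
      ← mul_coeff_geom_mul_geom b d hk]
    ring
  rw [zetaWord_sub_second_three]
  linear_combination h1 + h2 + h3 + h4 + h5 - h6

theorem contractions_depth_two_eq (n : ℕ) (a b c d : ℝ) :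
    sum₂ n (fun i j =>
        (quo a c i - c * a ^ (i - 1) - a * c ^ (i - 1)) * quo b d j * mzv ![i, j]) =
      a * b * c * d * (zetaWord n ![(geom a - X) * (geom c - X), geom b * geom d]
        - zetaWord n ![X ^ 2, geom b * geom d]) := by
  rw [zetaWord_two, zetaWord_two, sum₂_sub, mul_sum₂]
  refine sum₂_congr fun i j hi hj => ?_
  rw [← mul_coeff_geom_mul_geom b d hj]
  linear_combination (- b * d * coeff j (geom b * geom d) * mzv ![i, j]) *
    mul_coeff_geom_sub_X_mul a c hi

theorem ite_quo_mul_mzv {n : ℕ} (hn : 2 ≤ n) (a b c d : ℝ) :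
    (if n = 2 then 0 else a * c * quo b d (n - 2) * mzv ![2, n - 2]) =
      a * b * c * d * zetaWord n ![X ^ 2, geom b * geom d] := by
  rw [zetaWord_X_sq_two hn (by simp [geom])]
  split_ifs with h
  · simp [h, geom]
  · rw [← mul_coeff_geom_mul_geom b d (by omega)]
    ring

end DepthFour

open DepthFour in
theorem mainTheorem12 (a b c d : ℝ) (n : ℕ) (hn : 2 ≤ n) :
    symSum S₁ a b c d (fun a b c d =>
        sum₄ n (fun i j k l =>
          (a * b * c * (a + c) ^ (i - 1) * (b + c) ^ (j - 1) - a * b * c ^ i * (b + c) ^ (j - 1)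
              - c * a ^ i * b ^ j) * (b + d) ^ (k - 1) * d ^ l * mzv ![i, j, k, l])
        + sum₄ n (fun i j k l =>
          ((a + c) ^ (i - 1) - c ^ (i - 1)) * a * b * (b + c) ^ (j - 1) * c ^ k * d ^ l
            * mzv ![i, j, k, l])
        + sum₃ (n - 1) (fun i j l =>
          (b ^ j * d ^ l + d ^ j * b ^ l) * c * a ^ i * mzv ![i, 1, j, l])
        + sum₄ n (fun i j k l =>
          (a * c * d * (a + c) ^ (i - 1) * (b + c) ^ (j - 1) - a * d * c ^ i * (b + c) ^ (j - 1)
              - c * d * a ^ i * b ^ (j - 1)) * (b + d) ^ (k - 1) * b ^ l * mzv ![i, j, k, l]))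
    = symSum S₂ a b c d (fun a b c d =>
        sum₄ n (fun i j k l => a ^ i * b ^ j * c ^ k * d ^ l * mzv ![i, j, k, l]))
      + symSum S₁ a b c d (fun a b c d =>
        sum₃ n (fun i j k =>
          (quo b c j - c * b ^ (j - 1)) * a ^ i * d ^ k * mzv ![i, j, k])
        + sum₃ n (fun i j k =>
          (quo a c i - c * a ^ (i - 1) - a * c ^ (i - 1)) * b ^ j * d ^ k * mzv ![i, j, k])
        + sum₃ n (fun i j k => quo b d k * a ^ i * c ^ j * mzv ![i, j, k])
        + ∑ s ∈ compositions 2 (n - 2),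
            a * c * d ^ s 0 * b ^ s 1 * mzv ![2, s 0, s 1]
        + sum₂ (n - 1) (fun i k => c * a ^ i * d ^ k * mzv ![i, 1, k])
        - sum₂ (n - 1) (fun i k => quo b d k * a ^ i * c * mzv ![i, 1, k]))
      + sum₂ n (fun i j =>
          (quo a c i - c * a ^ (i - 1) - a * c ^ (i - 1)) * quo b d j * mzv ![i, j])
      -- the last term is absent for `n = 2`, where `ζ(2, 0)` is not a multiple zeta value
      + (if n = 2 then 0 else a * c * quo b d (n - 2) * mzv ![2, n - 2]) := by
  simp only [symSum_S₁, symSum_S₂]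
  rw [shuffle_sums_eq, shuffle_sums_eq, contractions_eq, contractions_eq, contractions_depth_two_eq,
    ite_quo_mul_mzv hn]
  simp only [sum₄_monomial]
  have h := (hasSum_shuffle n a b c d).unique (hasSum_stuffle n (X_sq_dvd_geom_sub a)
    (X_dvd_geom b) (X_sq_dvd_geom_sub c) (X_dvd_geom d))
  simp only [zetaWord_sub_second, zetaWord_sub_third] at h
  rw [mul_comm (geom d) (geom b)] at h ⊢
  rw [mul_comm (geom c - .X) (geom a - .X)]
  -- the words `(a, b, X, d)`, with `X` as third letter, occur on both sides and cancel
  linear_combination (a * b * c * d) * h
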